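/- Let $\Phi\in\mathbb{R}^{m\times n}$ and $K\ge 1$. Let $\|\cdot\|$ be the Euclidean norm. For $s\ge 1$ let $\delta_s$ be the restricted isometry constant of $\Phi$, i.e. the smallest $\delta\ge 0$ with $(1-\delta)\|x\|^2\le\|\Phi x\|^2\le(1+\delta)\|x\|^2$ for all $x\in\mathbb{R}^n$ having at most $s$ nonzero entries, and assume that $\delta_{3K}<1$. Let $\gamma_1,\dots,\gamma_n>0$, and let $g_1,\dots,g_n:\mathbb{R}\to\mathbb{R}$ be $C^2$ functions with $g_j'(0)=0$ and $g_j''(u)<1/\gamma_j$ for all $u\in\mathbb{R}$. Put $J(x)=\sum_j g_j(x_j)$, $\Gamma=\operatorname{diag}(\gamma_1,\dots,\gamma_n)$ and $\psi_j(u)=u-\gamma_j g_j'(u)$. For a measurement vector $y\in\mathbb{R}^m$ and a step size $\mu>0$, the regularized hard thresholding pursuit (RHTP) algorithm produces $x^{k+1}$ from $x^k$ ($k\ge 0$) as follows: $$\hat x^{k+1}=H_K\bigl(x^k+\mu\Phi^t(y-\Phi x^k)-\Gamma\nabla J(x^k)\bigr),\qquad \Lambda^{k+1}=\operatorname{supp}(\hat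 x^{k+1}),\qquad x^{k+1}\in\operatorname*{arg\,min}_{\operatorname{supp}(z)\subseteq\Lambda^{k+1}}\|y-\Phi z\|.$$ Here $H_K$ keeps $K$ entries of largest absolute value (all entries if $n\le K$), with ties broken arbitrarily, and sets the others to $0$. The algorithm is started at $x^0=0$ or, more generally, at any $x^0$ that minimizes $\|y-\Phi z\|$ over all $z$ supported in some set of at most $K$ indices. Let $x^\star\in\mathbb{R}^n$ have at most $K$ nonzero entries, and let $y=\Phi x^\star$. Let $\phi_i$ denote the $i$-th column of $\Phi$, and define $$B=\frac{\|y\|}{\sqrt{1-\delta_K}},\quad C_i=\max_{|u|\le B}\bigl(1-\gamma_i g_i''(u)\bigr),\quad D=\mu\max_i\|\phi_i\|\,\|y\|,\quad E_i=\max\{BC_i,D\},$$ $$l=\min_i\ \min_{u:\,|\psi_i(u)|\le E_i}\gamma_i g_i''(u),\qquad L=\max_i\ \max_{u:\,|\psi_i(u)|\le E_i}\gamma_i g_i''(u)$$ (read $\min$ and $\max$ as $\inf$ and $\sup$ if they are not attained), and $$\mu'_s=1-\frac{\mu(1-\delta_s)}{1-l},\qquad \rho_{3K}=\frac{\sqrt2\,\mu'_{3K}}{\sqrt{1-(\mu'_{2K})^2}}.$$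 Assume that $$\frac{\bigl(1-\frac1{\sqrt3}\bigr)(1-l)}{1-\delta_{3K}}<\mu<\frac{(1-L)^2}{(1-l)(1+\delta_{2K})}.$$ Then $0<\rho_{3K}<1$, and RHTP recovers $x^\star$ exactly in no more than $cK$ iterations, where $$c=\frac{\ln(4/\rho_{3K}^2)}{\ln(1/\rho_{3K}^2)}.$$ That is, there is an integer $N$ with $0\le N\le cK$ such that $x^k=x^\star$ for all $k\ge N$. -/

import Mathlib

noncomputable section

namespace RHTP

/-- `n`-dimensional real vectors with the Euclidean norm. -/
abbrev Vec (n : ℕ) : Type := EuclideanSpace ℝ (Fin n)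

/-- The matrix-vector product `Φ x`, as a vector with the Euclidean norm. -/
def mulV {m n : ℕ} (Φ : Matrix (Fin m) (Fin n) ℝ) (x : Vec n) : Vec m :=
  WithLp.toLp 2 (Φ.mulVec (fun i => x i))

/-- The support of a vector. -/
def supp {n : ℕ} (x : Vec n) : Finset (Fin n) :=
  Finset.univ.filter (fun i => x i ≠ 0)

/-- The restricted isometry inequalities of order `s` with constant `δ`. -/
def RIPWith {m n : ℕ} (Φ : Matrix (Fin m) (Fin n) ℝ) (s : ℕ) (δ : ℝ) : Prop :=
  ∀ x : Vec n, (supp x).card ≤ s →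
    (1 - δ) * ‖x‖ ^ 2 ≤ ‖mulV Φ x‖ ^ 2 ∧ ‖mulV Φ x‖ ^ 2 ≤ (1 + δ) * ‖x‖ ^ 2

/-- The restricted isometry constant `δ_s`: the smallest admissible `δ ≥ 0`.
The matrix satisfies the restricted isometry property of order `s` when `ric Φ s < 1`. -/
def ric {m n : ℕ} (Φ : Matrix (Fin m) (Fin n) ℝ) (s : ℕ) : ℝ :=
  sInf {δ : ℝ | 0 ≤ δ ∧ RIPWith Φ s δ}

/-- `ψ_i(u) = u - γ_i g_i'(u)`. -/
def psi {n : ℕ} (γ : Fin n → ℝ) (g : Fin n → ℝ → ℝ) (i : Fin n) (u : ℝ) : ℝ :=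
  u - γ i * deriv (g i) u

/-- The standing assumptions on the regularizer `J(x) = ∑ i, g_i(x_i)` and on the diagonal
`γ` of `Γ`. -/
structure IsRegularizer {n : ℕ} (γ : Fin n → ℝ) (g : Fin n → ℝ → ℝ) : Prop where
  gamma_pos : ∀ i, 0 < γ i
  contDiff : ∀ i, ContDiff ℝ 2 (g i)
  deriv_zero : ∀ i, deriv (g i) 0 = 0
  deriv_deriv_lt : ∀ i u, deriv (deriv (g i)) u < 1 / γ i

/-- `B = ‖y‖ / √(1 - δ_K)`. -/
def boundB {m n : ℕ} (Φ : Matrix (Fin m) (Fin n) ℝ) (K : ℕ) (y : Vec m) : ℝ :=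
  ‖y‖ / √(1 - ric Φ K)

/-- `C_i`, the maximum of `1 - γ_i g_i''(u)` over `u ∈ [-B, B]`. -/
def boundC {m n : ℕ} (Φ : Matrix (Fin m) (Fin n) ℝ) (K : ℕ) (γ : Fin n → ℝ)
    (g : Fin n → ℝ → ℝ) (y : Vec m) (i : Fin n) : ℝ :=
  sSup ((fun u => 1 - γ i * deriv (deriv (g i)) u) ''
    Set.Icc (-boundB Φ K y) (boundB Φ K y))

/-- The `i`-th column of `Φ`. -/
def col {m n : ℕ} (Φ : Matrix (Fin m) (Fin n) ℝ) (i : Fin n) : Vec m :=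
  WithLp.toLp 2 (fun j => Φ j i)

/-- `D = μ (max_i ‖φ_i‖) ‖y‖`. -/
def boundD {m n : ℕ} (Φ : Matrix (Fin m) (Fin n) ℝ) (μ : ℝ) (y : Vec m) : ℝ :=
  μ * (⨆ i, ‖col Φ i‖) * ‖y‖

/-- `E_i = max {B C_i, D}`. -/
def boundE {m n : ℕ} (Φ : Matrix (Fin m) (Fin n) ℝ) (K : ℕ) (μ : ℝ) (γ : Fin n → ℝ)
    (g : Fin n → ℝ → ℝ) (y : Vec m) (i : Fin n) : ℝ :=
  max (boundB Φ K y * boundC Φ K γ g y i) (boundD Φ μ y)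

/-- The values `γ_i g_i''(u)`, over all `i` and all `u ∈ [ψ_i⁻¹(-E_i), ψ_i⁻¹(E_i)]`.
Since `ψ_i` is strictly increasing, this interval is `{u | -E_i ≤ ψ_i(u) ≤ E_i}`. -/
def curvatures {m n : ℕ} (Φ : Matrix (Fin m) (Fin n) ℝ) (K : ℕ) (μ : ℝ) (γ : Fin n → ℝ)
    (g : Fin n → ℝ → ℝ) (y : Vec m) : Set ℝ :=
  {c : ℝ | ∃ i : Fin n, ∃ u : ℝ,
    psi γ g i u ∈ Set.Icc (-boundE Φ K μ γ g y i) (boundE Φ K μ γ g y i) ∧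
      c = γ i * deriv (deriv (g i)) u}

/-- `l`, the smallest of the values `γ_i g_i''(u)`. -/
def lowerL {m n : ℕ} (Φ : Matrix (Fin m) (Fin n) ℝ) (K : ℕ) (μ : ℝ) (γ : Fin n → ℝ)
    (g : Fin n → ℝ → ℝ) (y : Vec m) : ℝ :=
  sInf (curvatures Φ K μ γ g y)

/-- `L`, the largest of the values `γ_i g_i''(u)`. -/
def upperL {m n : ℕ} (Φ : Matrix (Fin m) (Fin n) ℝ) (K : ℕ) (μ : ℝ) (γ : Fin n → ℝ)
    (g : Fin n → ℝ → ℝ) (y : Vec m) : ℝ :=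
  sSup (curvatures Φ K μ γ g y)

/-- `μ'_s = 1 - μ (1 - δ_s) / (1 - l)`, as a function of `l`. -/
def muPrime {m n : ℕ} (Φ : Matrix (Fin m) (Fin n) ℝ) (μ l : ℝ) (s : ℕ) : ℝ :=
  1 - μ * (1 - ric Φ s) / (1 - l)

/-- `ρ_{3K} = √2 μ'_{3K} / √(1 - (μ'_{2K})²)`, as a function of `l`. -/
def rho {m n : ℕ} (Φ : Matrix (Fin m) (Fin n) ℝ) (μ l : ℝ) (K : ℕ) : ℝ :=
  √2 * muPrime Φ μ l (3 * K) / √(1 - muPrime Φ μ l (2 * K) ^ 2)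

/-- `w = H_K(v)`: `w` keeps `K` entries of `v` of largest absolute value (all of them if
`n ≤ K`) and is zero elsewhere; ties may be broken in any way. -/
def IsHardThreshold {n : ℕ} (K : ℕ) (v w : Vec n) : Prop :=
  ∃ S : Finset (Fin n), S.card = min K n ∧ (∀ i ∈ S, ∀ j ∉ S, |v j| ≤ |v i|) ∧
    (∀ i ∈ S, w i = v i) ∧ (∀ i ∉ S, w i = 0)

/-- `x` minimizes `‖y - Φ z‖` over all `z` with support contained in `Λ`. -/
def IsLeastSquares {m n : ℕ} (Φ : Matrix (Fin m) (Fin n) ℝ) (y : Vec m)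
    (Λ : Finset (Fin n)) (x : Vec n) : Prop :=
  supp x ⊆ Λ ∧ ∀ z : Vec n, supp z ⊆ Λ → ‖y - mulV Φ x‖ ≤ ‖y - mulV Φ z‖

/-- The vector `x + μ Φᵗ (y - Φ x) - Γ ∇J(x)`, where `(Γ ∇J(x))_i = γ_i g_i'(x_i)`. -/
def gradStep {m n : ℕ} (Φ : Matrix (Fin m) (Fin n) ℝ) (y : Vec m) (μ : ℝ) (γ : Fin n → ℝ)
    (g : Fin n → ℝ → ℝ) (x : Vec n) : Vec n :=
  x + μ • mulV Φ.transpose (y - mulV Φ x) - WithLp.toLp 2 (fun i => γ i * deriv (g i) (x i))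

/-- One iteration of RHTP, from `x` to `x'`. -/
def IsStep {m n : ℕ} (Φ : Matrix (Fin m) (Fin n) ℝ) (y : Vec m) (K : ℕ) (μ : ℝ)
    (γ : Fin n → ℝ) (g : Fin n → ℝ → ℝ) (x x' : Vec n) : Prop :=
  ∃ xhat : Vec n, IsHardThreshold K (gradStep Φ y μ γ g x) xhat ∧
    IsLeastSquares Φ y (supp xhat) x'

/-- `x` is a sequence of iterates of RHTP. The initial estimate is, like all later iterates,
a least squares estimate on some set of at most `K` indices; the standard choice `x 0 = 0`
is the case of the empty set. -/
structure IsRun {m n : ℕ} (Φ : Matrix (Fin m) (Fin n) ℝ) (y : Vec m) (K : ℕ) (μ : ℝ)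
    (γ : Fin n → ℝ) (g : Fin n → ℝ → ℝ) (x : ℕ → Vec n) : Prop where
  init : ∃ Λ₀ : Finset (Fin n), Λ₀.card ≤ K ∧ IsLeastSquares Φ y Λ₀ (x 0)
  step : ∀ k, IsStep Φ y K μ γ g (x k) (x (k + 1))

end RHTP

end

/-! Let `W k` be the missed energy, the sum of `xstar i ^ 2` over `i ∉ Λ k`. It shrinks by the
factor `ρ ^ 2` at every step, and `x k = xstar` once it vanishes.

Put `e = x k - xstar`. Since `y = Φ xstar`, least squares makes `Φᵗ Φ e` vanish on `Λ k`; there the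
vector to be thresholded is just `ψ_i(x_i)`, of size between `1 - L` and `1 - l` times `|x_i|`. Off
`Λ k` the regularizer disappears, as `x_i = 0`. After division by `1 - L` this is an ordinary
pursuit step, up to a distortion `t = (1 - l) / (1 - L)`. Restricted isometry bounds `e - τ Φᵗ Φ e`
on `3K` coordinates (`sum_residualMap_sq_le`), thresholding charges missed entries to wrongly chosen
ones (`IsHardThreshold.sum_compl_sq_le`), and `contraction_factor_le` shows that `t = 1` is the
worst case, which is `ρ`.

Geometric decay alone gives a count that depends on the sizes of the entries.
`exists_sum_compl_eq_zero_of_sum_le` removes this dependence: an entry is captured once `W` falls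
below its square, so blocks of comparable entries are captured in turn. The cost of a block is
logarithmic in the remaining energy over its largest square, and these logarithms add up to at most
a multiple of the number of entries. -/

namespace RHTP

/-! ### Counting iterations under geometric decay -/

open Finset in
/-- If the weight outside `Λ k` decays geometrically with ratio `r`, then `Λ k` contains the support
of the weight after at most `log (4 / r) / log (1 / r)` steps per point of the support. -/
theorem exists_sum_compl_eq_zero_of_sum_le {ι : Type*} [Fintype ι] [DecidableEq ι]
    {a : ι → ℝ} (ha : ∀ i, 0 ≤ a i) {Λ : ℕ → Finset ι} {r : ℝ} (hr0 : 0 < r) (hr1 : r < 1)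
    (hd : ∀ k, ∑ i ∈ (Λ (k + 1))ᶜ, a i ≤ r * ∑ i ∈ (Λ k)ᶜ, a i) (R : Finset ι) :
    (∀ i ∈ R, 0 < a i) → (∀ i ∈ R, ∀ j ∉ R, 0 < a j → a i ≤ a j) →
    ∀ (M : ℝ), 0 < M → (∀ i ∈ R, a i ≤ M) → ∀ n, ∑ i ∈ (Λ n)ᶜ, a i ≤ ∑ i ∈ R, a i →
    ∃ N : ℕ, ∑ i ∈ (Λ (n + N))ᶜ, a i = 0 ∧
      N * Real.log (1 / r) ≤
        #R * (Real.log (1 / r) + Real.log 4) - (∑ i ∈ R, a i) / M / 2 := by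
  induction R using Finset.strongInduction with
  | H R ih =>
  intro hpos hlow M₁ hM₁ hRM₁ n hn
  rcases R.eq_empty_or_nonempty with rfl | hne
  · exact ⟨0, le_antisymm (by simpa using hn) (sum_nonneg fun i _ => ha i), by simp⟩
  obtain ⟨i₀, hi₀, hmax⟩ := R.exists_max_image a hne
  set M := a i₀ with hMdef
  have hM : 0 < M := hpos i₀ hi₀
  -- The weights above half the maximum form a block `Q`, captured within `k` steps; `R'` is left to
  -- the induction.
  set R' := R.filter (fun i => a i ≤ M / 2) with hR'
  set Q := R.filter (fun i => ¬ a i ≤ M / 2) with hQ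
  have hi₀Q : i₀ ∈ Q := by simp [hQ, hi₀]; linarith
  have hR'R : R' ⊂ R := by
    refine ⟨filter_subset _ _, fun h => ?_⟩
    have := (mem_filter.1 (h hi₀)).2
    linarith
  have hcard : (#R : ℝ) = #R' + #Q := by
    exact_mod_cast (card_filter_add_card_filter_not (s := R) (fun i => a i ≤ M / 2)).symm
  have hsum : ∑ i ∈ R, a i = ∑ i ∈ R', a i + ∑ i ∈ Q, a i :=
    (sum_filter_add_sum_filter_not R (fun i => a i ≤ M / 2) a).symm
  have hQsum : ∑ i ∈ Q, a i ≤ #Q * M := by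
    rw [← nsmul_eq_mul]
    exact sum_le_card_nsmul _ _ _ fun i hi => hmax i (mem_filter.1 hi).1
  have hQ1 : (1 : ℝ) ≤ #Q := by exact_mod_cast card_pos.2 ⟨i₀, hi₀Q⟩
  set lam := Real.log (1 / r) with hlam
  have hlam0 : 0 < lam := Real.log_pos (by rw [lt_div_iff₀ hr0]; linarith)
  have hr_exp : r = Real.exp (-lam) := by
    rw [hlam, one_div, Real.log_inv, neg_neg, Real.exp_log hr0]
  have hlog4 : 1 ≤ Real.log 4 := by
    have : Real.log 4 = 2 * Real.log 2 := by
      rw [show (4 : ℝ) = 2 ^ 2 by norm_num, Real.log_pow]; norm_num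
    linarith [Real.log_two_gt_d9]
  set σ := ∑ i ∈ R, a i with hσ
  have hσM : M ≤ σ := single_le_sum (f := a) (fun i _ => ha i) hi₀
  set τ := σ / M with hτ
  have hτ1 : 1 ≤ τ := by rw [hτ, le_div_iff₀ hM]; linarith
  set k := ⌈Real.log (2 * τ) / lam⌉₊ with hk
  have hlogτ : 0 ≤ Real.log (2 * τ) := Real.log_nonneg (by linarith)
  have hk_lt : (k : ℝ) * lam ≤ lam + Real.log (2 * τ) := by
    have h := (Nat.ceil_lt_add_one (div_nonneg hlogτ hlam0.le)).le
    calc (k : ℝ) * lam ≤ (Real.log (2 * τ) / lam + 1) * lam := by gcongr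
      _ = lam + Real.log (2 * τ) := by field_simp; ring
  -- Tangent to the logarithm at `τ = 2`. This is where the constant 4 arises.
  have hlog_le : Real.log (2 * τ) ≤ Real.log 4 + τ / 2 - 1 := by
    have h := Real.log_le_sub_one_of_pos (show 0 < τ / 2 by linarith)
    have : Real.log (2 * τ) = Real.log 4 + Real.log (τ / 2) := by
      rw [← Real.log_mul (by norm_num) (by linarith)]; congr 1; ring
    linarith
  have hrk : r ^ k * σ ≤ M / 2 := by
    have h1 : Real.log (2 * τ) ≤ k * lam := by
      rw [← div_le_iff₀ hlam0]; exact Nat.le_ceil _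
    have h2 : 2 * τ ≤ Real.exp (k * lam) := by
      rwa [← Real.log_le_iff_le_exp (by linarith)]
    have h3 : r ^ k = (Real.exp (k * lam))⁻¹ := by
      rw [hr_exp, ← Real.exp_nat_mul, ← Real.exp_neg]; ring_nf
    have h4 : σ = τ * M := by rw [hτ]; field_simp
    rw [h3, inv_mul_le_iff₀ (Real.exp_pos _), h4]
    nlinarith
  have hiter : ∀ j, ∑ i ∈ (Λ (n + j))ᶜ, a i ≤ r ^ j * σ := by
    intro j
    induction j with
    | zero => simpa using hn
    | succ j hj =>
      calc _ ≤ r * ∑ i ∈ (Λ (n + j))ᶜ, a i := hd (n + j)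
        _ ≤ r * (r ^ j * σ) := by gcongr
        _ = _ := by ring
  have hmem : ∀ j, M / 2 < a j → j ∈ Λ (n + k) := by
    intro j hj
    by_contra hcon
    have := single_le_sum (f := a) (fun i _ => ha i) (mem_compl.2 hcon)
    linarith [hiter k]
  have hR'sum : ∑ i ∈ (Λ (n + k))ᶜ, a i ≤ ∑ i ∈ R', a i := by
    have h : ∑ i ∈ (Λ (n + k))ᶜ, a i = ∑ i ∈ (Λ (n + k))ᶜ ∩ R', a i := by
      refine (sum_subset inter_subset_left fun i hi hi' => ?_).symm
      by_contra h0
      have hai : 0 < a i := lt_of_le_of_ne (ha i) (Ne.symm h0)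
      have hiM : a i ≤ M / 2 := not_lt.1 fun h => mem_compl.1 hi (hmem i h)
      by_cases hiR : i ∈ R
      · exact hi' (mem_inter.2 ⟨hi, mem_filter.2 ⟨hiR, hiM⟩⟩)
      · linarith [hlow i₀ hi₀ i hiR hai]
    rw [h]
    exact sum_le_sum_of_subset_of_nonneg inter_subset_right fun i _ _ => ha i
  obtain ⟨N, hN0, hN⟩ := ih R' hR'R (fun i hi => hpos i (hR'R.1 hi))
    (fun i hi j hj haj => by
      by_cases hjR : j ∈ R
      · have h1 := (mem_filter.1 hi).2
        have h2 : ¬ a j ≤ M / 2 := fun h => hj (mem_filter.2 ⟨hjR, h⟩)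
        linarith
      · exact hlow i (hR'R.1 hi) j hjR haj)
    (M / 2) (by linarith) (fun i hi => (mem_filter.1 hi).2) (n + k) hR'sum
  refine ⟨k + N, by rwa [← add_assoc], ?_⟩
  have hτM₁ : σ / M₁ ≤ τ :=
    div_le_div_of_nonneg_left (by linarith) hM (hRM₁ i₀ hi₀)
  have hτ' : τ ≤ #Q + (∑ i ∈ R', a i) / (M / 2) / 2 := by
    rw [hτ, hsum, div_le_iff₀ hM]
    have : (#Q + (∑ i ∈ R', a i) / (M / 2) / 2) * M = #Q * M + ∑ i ∈ R', a i := by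
      rw [add_mul, div_div_eq_mul_div, div_div, div_mul_eq_mul_div]
      congr 1
      rw [div_eq_iff (by positivity)]
      ring
    linarith
  push_cast
  rw [hcard]
  -- Half of `τ` comes from the logarithm, half from the term subtracted in the goal. Their sum is
  -- at most `#Q` plus the surplus left by `R'`, so what remains is `(#Q - 1) * (lam + log 4 - 1) ≥
  -- 0`.
  linear_combination hN + hk_lt + hlog_le + hτM₁ / 2 + hτ' +
    mul_nonneg (sub_nonneg.2 hQ1) (sub_nonneg.2 hlog4) + mul_nonneg (sub_nonneg.2 hQ1) hlam0.le

/-! ### Worst case of the distortion `t` -/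

/-- The scalar inequality behind the contraction factor. -/
theorem contraction_factor_le {a p t : ℝ} (ha : 1 - 1 / √3 < a) (hap : a ≤ p) (ht : 1 ≤ t)
    (htp : t ^ 2 * p < 1) :
    ((1 - t * a) ^ 2 + (t ^ 2 - 1) * (1 - t ^ 2 * p) ^ 2) * (1 - (1 - p) ^ 2) ≤
      (1 - a) ^ 2 * (1 - (1 - t ^ 2 * p) ^ 2) := by
  -- With `t ^ 2 * p < 1` this forces `t < 1.55`, small enough for `h2`.
  have ha' : 0.42 < a := by
    have h3 : (1.73 : ℝ) ≤ √3 := Real.le_sqrt_of_sq_le (by norm_num)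
    have : 1 / √3 ≤ 1 / 1.73 := by gcongr
    linarith
  have ht1 : 1 ≤ t ^ 2 := one_le_pow₀ ht
  have hp1 : p < 1 := by nlinarith
  have ht2 : t < 1.55 := by nlinarith
  have hat : t * a < 1 := by nlinarith
  set u := 1 - t ^ 2 * p with hu
  have hu0 : 0 < u := by linarith
  have hup : u ≤ 1 - p := by nlinarith
  have h1 : -((1 - p) * (1 - a) * a) ≤ (1 - p + u) * (1 - a) ^ 2 - (2 - p) * u ^ 2 := by
    have e1 : (2 - p) * u ^ 2 ≤ (2 - p) * (u * (1 - p)) := by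
      rw [sq]; gcongr; linarith
    have e2 : (1 - p) * (2 - p) ≤ (1 - a) * (2 - a) := by nlinarith
    have e3 := mul_le_mul_of_nonneg_left e2 hu0.le
    have e4 : u * ((1 - a) * a) ≤ (1 - p) * ((1 - a) * a) :=
      mul_le_mul_of_nonneg_right hup (by nlinarith)
    have e5 : 0 ≤ (1 - p - u) * (1 - a) ^ 2 := mul_nonneg (by linarith) (sq_nonneg _)
    nlinarith
  have h2 : (1 + t) * (1 - a) * (1 - p) ≤ (2 - p) * (2 - a * (1 + t)) := by
    have e1 : (1 + t) * (1 - p) ≤ 2 - p := by nlinarith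
    have e2 : (1 + t) * (1 - p) * (1 - a) ≤ (2 - p) * (1 - a) :=
      mul_le_mul_of_nonneg_right e1 (by linarith)
    have e3 : 0 ≤ (2 - p) * (1 - t * a) := mul_nonneg (by linarith) (by linarith)
    nlinarith
  have h3 : 0 ≤ (2 - p) * a * (2 - a * (1 + t)) +
      (t + 1) * ((1 - p + u) * (1 - a) ^ 2 - (2 - p) * u ^ 2) := by
    have e1 := mul_le_mul_of_nonneg_left h1 (show 0 ≤ t + 1 by linarith)
    have e2 := mul_le_mul_of_nonneg_left h2 (show 0 ≤ a by linarith)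
    nlinarith
  have h4 := mul_nonneg (mul_nonneg (show 0 ≤ p by linarith) (sub_nonneg.2 ht)) h3
  -- The two sides agree at `t = 1`, so `t - 1` factors out; the cofactor is the one treated in
  -- `h3`.
  have h5 : (1 - a) ^ 2 * (1 - u ^ 2) -
      ((1 - t * a) ^ 2 + (t ^ 2 - 1) * u ^ 2) * (1 - (1 - p) ^ 2) =
      p * (t - 1) * ((2 - p) * a * (2 - a * (1 + t)) +
      (t + 1) * ((1 - p + u) * (1 - a) ^ 2 - (2 - p) * u ^ 2)) := by
    rw [hu]; ring
  linarith

/-! ### Supports, adjoints and restricted isometry constants -/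

variable {m n : ℕ}

@[simp] theorem mem_supp {x : Vec n} {i : Fin n} : i ∈ supp x ↔ x i ≠ 0 := by simp [supp]

theorem supp_subset_iff {x : Vec n} {T : Finset (Fin n)} :
    supp x ⊆ T ↔ ∀ i ∉ T, x i = 0 := by
  constructor
  · intro h i hi
    by_contra h0
    exact hi (h (mem_supp.2 h0))
  · intro h i hi
    by_contra h0
    exact mem_supp.1 hi (h i h0)

theorem mulV_add (Φ : Matrix (Fin m) (Fin n) ℝ) (x z : Vec n) :
    mulV Φ (x + z) = mulV Φ x + mulV Φ z := map_add (Matrix.toEuclideanLin Φ) x z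

theorem mulV_sub (Φ : Matrix (Fin m) (Fin n) ℝ) (x z : Vec n) :
    mulV Φ (x - z) = mulV Φ x - mulV Φ z := map_sub (Matrix.toEuclideanLin Φ) x z

theorem mulV_smul (Φ : Matrix (Fin m) (Fin n) ℝ) (c : ℝ) (x : Vec n) :
    mulV Φ (c • x) = c • mulV Φ x := map_smul (Matrix.toEuclideanLin Φ) c x

theorem inner_mulV (Φ : Matrix (Fin m) (Fin n) ℝ) (z : Vec n) (w : Vec m) :
    inner ℝ (mulV Φ z) w = inner ℝ z (mulV Φ.transpose w) := by
  simp only [EuclideanSpace.inner_eq_star_dotProduct, mulV, star_trivial]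
  change w.ofLp ⬝ᵥ Φ.mulVec z.ofLp = Φ.transpose.mulVec w.ofLp ⬝ᵥ z.ofLp
  rw [Matrix.dotProduct_mulVec, Matrix.mulVec_transpose]

theorem ric_nonneg (Φ : Matrix (Fin m) (Fin n) ℝ) (s : ℕ) : 0 ≤ ric Φ s :=
  Real.sInf_nonneg fun _ h => h.1

/-- Guarantees that the infimum defining `ric` is not the default value on an empty set. -/
theorem exists_ripWith (Φ : Matrix (Fin m) (Fin n) ℝ) (s : ℕ) : ∃ δ, 0 ≤ δ ∧ RIPWith Φ s δ := by
  set A := (Matrix.toEuclideanLin Φ).toContinuousLinearMap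
  refine ⟨1 + ‖A‖ ^ 2, by positivity, fun x _ => ⟨?_, ?_⟩⟩
  · have : 0 ≤ ‖A‖ ^ 2 * ‖x‖ ^ 2 := by positivity
    nlinarith [sq_nonneg ‖mulV Φ x‖]
  · have h : ‖mulV Φ x‖ ≤ ‖A‖ * ‖x‖ := A.le_opNorm x
    have h2 : ‖mulV Φ x‖ ^ 2 ≤ (‖A‖ * ‖x‖) ^ 2 := by gcongr
    nlinarith [sq_nonneg ‖x‖]

/-- The inequalities are closed conditions on `δ`, so the infimum is attained. -/
theorem ripWith_ric (Φ : Matrix (Fin m) (Fin n) ℝ) (s : ℕ) : RIPWith Φ s (ric Φ s) := by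
  intro x hx
  have key : ∀ ε : ℝ, 0 < ε → (1 - (ric Φ s + ε)) * ‖x‖ ^ 2 ≤ ‖mulV Φ x‖ ^ 2 ∧
      ‖mulV Φ x‖ ^ 2 ≤ (1 + (ric Φ s + ε)) * ‖x‖ ^ 2 := by
    intro ε hε
    obtain ⟨δ, ⟨_, hδ⟩, hlt⟩ := exists_lt_of_csInf_lt (s := {δ : ℝ | 0 ≤ δ ∧ RIPWith Φ s δ})
      (exists_ripWith Φ s) (show ric Φ s < ric Φ s + ε by linarith)
    have h := hδ x hx
    constructor
    · nlinarith [sq_nonneg ‖x‖]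
    · nlinarith [sq_nonneg ‖x‖]
  rcases (sq_nonneg ‖x‖).eq_or_lt with h0 | h0
  · have := key 1 one_pos
    rw [← h0] at this ⊢
    constructor <;> linarith
  · constructor <;> refine le_of_forall_pos_le_add fun ε hε => ?_
    · have := (key (ε / ‖x‖ ^ 2) (by positivity)).1
      have h1 : ε / ‖x‖ ^ 2 * ‖x‖ ^ 2 = ε := div_mul_cancel₀ _ h0.ne'
      linarith
    · have := (key (ε / ‖x‖ ^ 2) (by positivity)).2
      have h1 : ε / ‖x‖ ^ 2 * ‖x‖ ^ 2 = ε := div_mul_cancel₀ _ h0.ne'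
      linarith

theorem ric_mono (Φ : Matrix (Fin m) (Fin n) ℝ) {s s' : ℕ} (h : s ≤ s') : ric Φ s ≤ ric Φ s' :=
  csInf_le_csInf ⟨0, fun _ h => h.1⟩ (exists_ripWith Φ s')
    fun _ hδ => ⟨hδ.1, fun x hx => hδ.2 x (hx.trans h)⟩

/-- The vector `e - τ Φᵗ Φ e`. -/
def residualMap (Φ : Matrix (Fin m) (Fin n) ℝ) (τ : ℝ) (e : Vec n) : Vec n :=
  e - τ • mulV Φ.transpose (mulV Φ e)

theorem residualMap_apply (Φ : Matrix (Fin m) (Fin n) ℝ) (τ : ℝ) (e : Vec n) (i : Fin n) :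
    residualMap Φ τ e i = e i - τ * mulV Φ.transpose (mulV Φ e) i := by
  simp [residualMap]

/-- The compression of `I - τ Φᵗ Φ` to the coordinates in `T` is symmetric, and restricted isometry
bounds its quadratic form by `c`; hence its norm is at most `c`. -/
theorem sum_residualMap_sq_le (Φ : Matrix (Fin m) (Fin n) ℝ) {s : ℕ} {T : Finset (Fin n)}
    (hT : T.card ≤ s) {τ : ℝ} (hτ0 : 0 ≤ τ) (hτ1 : τ ≤ 1) (hc : 0 < 1 - τ * (1 - ric Φ s))
    {e : Vec n} (he : supp e ⊆ T) :
    ∑ i ∈ T, residualMap Φ τ e i ^ 2 ≤ (1 - τ * (1 - ric Φ s)) ^ 2 * ‖e‖ ^ 2 := by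
  set c := 1 - τ * (1 - ric Φ s) with hcdef
  set z : Vec n := WithLp.toLp 2 (fun i => if i ∈ T then residualMap Φ τ e i else 0) with hz
  have hz_apply : ∀ i, z i = if i ∈ T then residualMap Φ τ e i else 0 := fun i => rfl
  have hzz : ‖z‖ ^ 2 = ∑ i ∈ T, residualMap Φ τ e i ^ 2 := by
    rw [EuclideanSpace.real_norm_sq_eq]
    simp [hz_apply, ite_pow]
  have hB : inner ℝ z e - τ * inner ℝ (mulV Φ z) (mulV Φ e) = ‖z‖ ^ 2 := by
    rw [inner_mulV, ← inner_smul_right, ← inner_sub_right, ← residualMap.eq_1 Φ τ e, hzz]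
    rw [PiLp.inner_apply]
    simp [hz_apply, sq]
  -- The condition `τ ≤ 1` is what gives `1 - τ * (1 + δ) ≥ -c`.
  have hQ : ∀ w : Vec n, supp w ⊆ T → |‖w‖ ^ 2 - τ * ‖mulV Φ w‖ ^ 2| ≤ c * ‖w‖ ^ 2 := by
    intro w hw
    have h := ripWith_ric Φ s w ((Finset.card_le_card hw).trans hT)
    have h1 := mul_le_mul_of_nonneg_left h.1 hτ0
    have h2 := mul_le_mul_of_nonneg_left h.2 hτ0
    have h3 : 0 ≤ (1 - τ) * ‖w‖ ^ 2 := mul_nonneg (by linarith) (sq_nonneg _)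
    rw [abs_le]
    constructor <;> rw [hcdef] <;> nlinarith
  have hsz : supp z ⊆ T := supp_subset_iff.2 fun i hi => by simp [hz_apply, hi]
  -- Polarization at `c⁻¹ • z ± e`; the weight `c⁻¹` balances the expected `‖z‖ ≤ c * ‖e‖`.
  have hcomb : ∀ b : ℝ, supp (c⁻¹ • z + b • e) ⊆ T := fun b => supp_subset_iff.2 fun i hi => by
    simp [supp_subset_iff.1 hsz i hi, supp_subset_iff.1 he i hi]
  have h1 := (abs_le.1 (hQ _ (hcomb 1))).2
  have h2 := (abs_le.1 (hQ _ (hcomb (-1)))).1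
  simp only [mulV_add, mulV_smul] at h1 h2
  simp only [norm_add_sq_real, inner_smul_left, inner_smul_right, norm_smul, mul_pow,
    Real.norm_eq_abs, sq_abs, abs_one, abs_neg, conj_trivial] at h1 h2
  have h3 : 4 * (c⁻¹ * ‖z‖ ^ 2) ≤ 2 * c * (c⁻¹ ^ 2 * ‖z‖ ^ 2 + ‖e‖ ^ 2) := by
    rw [← hB] at *
    nlinarith
  have h4 : c * (4 * (c⁻¹ * ‖z‖ ^ 2)) = 4 * ‖z‖ ^ 2 := by field_simp
  have h5 : c * (2 * c * (c⁻¹ ^ 2 * ‖z‖ ^ 2 + ‖e‖ ^ 2)) = 2 * ‖z‖ ^ 2 + 2 * (c ^ 2 * ‖e‖ ^ 2) := by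
    field_simp
  have h6 := mul_le_mul_of_nonneg_left h3 hc.le
  rw [← hzz]
  linarith

/-! ### Least squares estimates -/

theorem IsLeastSquares.inner_eq_zero {Φ : Matrix (Fin m) (Fin n) ℝ} {y : Vec m}
    {Λ : Finset (Fin n)} {x : Vec n} (h : IsLeastSquares Φ y Λ x) {z : Vec n} (hz : supp z ⊆ Λ) :
    inner ℝ (y - mulV Φ x) (mulV Φ z) = 0 := by
  set w := y - mulV Φ x with hw
  set q := mulV Φ z with hq
  set c := inner ℝ w q with hc
  have h1 : ∀ s : ℝ, 0 ≤ -2 * s * c + s ^ 2 * ‖q‖ ^ 2 := by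
    intro s
    have h2 := h.2 (x + s • z) (supp_subset_iff.2 fun i hi => by
      simp [supp_subset_iff.1 hz i hi, supp_subset_iff.1 h.1 i hi])
    rw [mulV_add, mulV_smul, ← sub_sub] at h2
    have h3 : ‖w‖ ^ 2 ≤ ‖w - s • q‖ ^ 2 := by gcongr
    rw [norm_sub_sq_real w (s • q), inner_smul_right, norm_smul, mul_pow, Real.norm_eq_abs, sq_abs] at h3
    linarith
  -- The added 1 keeps the test step `c / (‖q‖ ^ 2 + 1)` meaningful when `q = 0`.
  have hQ : 0 < ‖q‖ ^ 2 + 1 := by positivity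
  have h2 := h1 (c / (‖q‖ ^ 2 + 1))
  have h3 : -2 * (c / (‖q‖ ^ 2 + 1)) * c + (c / (‖q‖ ^ 2 + 1)) ^ 2 * ‖q‖ ^ 2 =
      -(c ^ 2 * (‖q‖ ^ 2 + 2)) / (‖q‖ ^ 2 + 1) ^ 2 := by
    field_simp; ring
  rw [h3, div_nonneg_iff] at h2
  have h4 : c ^ 2 ≤ 0 := by
    rcases h2 with h2 | h2
    · nlinarith [h2.1, sq_nonneg c, sq_nonneg ‖q‖, mul_nonneg (sq_nonneg c) (sq_nonneg ‖q‖)]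
    · have : 0 < (‖q‖ ^ 2 + 1) ^ 2 := by positivity
      linarith [h2.2]
  exact pow_eq_zero_iff two_ne_zero |>.1 (le_antisymm h4 (sq_nonneg c))

theorem IsLeastSquares.transpose_apply_eq_zero {Φ : Matrix (Fin m) (Fin n) ℝ} {y : Vec m}
    {Λ : Finset (Fin n)} {x : Vec n} (h : IsLeastSquares Φ y Λ x) {i : Fin n} (hi : i ∈ Λ) :
    mulV Φ.transpose (y - mulV Φ x) i = 0 := by
  have h1 := h.inner_eq_zero (z := EuclideanSpace.single i 1) (supp_subset_iff.2 fun j hj => by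
    have : j ≠ i := fun h => hj (h ▸ hi)
    simp [this])
  rw [real_inner_comm, inner_mulV, EuclideanSpace.inner_single_left] at h1
  simpa using h1

theorem IsLeastSquares.norm_mulV_le {Φ : Matrix (Fin m) (Fin n) ℝ} {y : Vec m}
    {Λ : Finset (Fin n)} {x : Vec n} (h : IsLeastSquares Φ y Λ x) : ‖mulV Φ x‖ ≤ ‖y‖ := by
  have h1 := h.inner_eq_zero h.1
  have h2 : ‖y‖ ^ 2 = ‖y - mulV Φ x‖ ^ 2 + ‖mulV Φ x‖ ^ 2 := by
    have := norm_add_sq_real (y - mulV Φ x) (mulV Φ x)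
    rw [h1, sub_add_cancel] at this
    linarith
  exact (sq_le_sq₀ (norm_nonneg _) (norm_nonneg _)).1 (by nlinarith [sq_nonneg ‖y - mulV Φ x‖])

/-- Confines every iterate to the range on which `boundC` controls the curvature. -/
theorem IsLeastSquares.norm_le_boundB {Φ : Matrix (Fin m) (Fin n) ℝ} {y : Vec m} {K : ℕ}
    {Λ : Finset (Fin n)} {x : Vec n} (h : IsLeastSquares Φ y Λ x) (hΛ : Λ.card ≤ K)
    (hδ : ric Φ K < 1) : ‖x‖ ≤ boundB Φ K y := by
  have h1 := (ripWith_ric Φ K x ((Finset.card_le_card h.1).trans hΛ)).1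
  have h0 : 0 < 1 - ric Φ K := by linarith
  rw [boundB, le_div_iff₀ (Real.sqrt_pos.2 h0)]
  refine (sq_le_sq₀ (by positivity) (norm_nonneg _)).1 ?_
  rw [mul_pow, Real.sq_sqrt h0.le]
  have : ‖mulV Φ x‖ ^ 2 ≤ ‖y‖ ^ 2 := by
    have := h.norm_mulV_le
    gcongr
  linarith

/-! ### Curvature bounds for the regularizer -/

theorem IsRegularizer.differentiable_deriv {γ : Fin n → ℝ} {g : Fin n → ℝ → ℝ}
    (h : IsRegularizer γ g) (i : Fin n) :
    Differentiable ℝ (deriv (g i)) ∧ Continuous (deriv (deriv (g i))) := by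
  have h2 : ContDiff ℝ (1 + 1) (g i) := by simpa [one_add_one_eq_two] using h.contDiff i
  have h1 : ContDiff ℝ 1 (deriv (g i)) := (contDiff_succ_iff_deriv.1 h2).2.2
  exact ⟨h1.differentiable one_ne_zero, h1.continuous_deriv le_rfl⟩

theorem IsRegularizer.hasDerivAt_psi {γ : Fin n → ℝ} {g : Fin n → ℝ → ℝ}
    (h : IsRegularizer γ g) (i : Fin n) (u : ℝ) :
    HasDerivAt (psi γ g i) (1 - γ i * deriv (deriv (g i)) u) u :=
  (hasDerivAt_id u).sub (((h.differentiable_deriv i).1 u).hasDerivAt.const_mul (γ i))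

theorem IsRegularizer.psi_zero {γ : Fin n → ℝ} {g : Fin n → ℝ → ℝ}
    (h : IsRegularizer γ g) (i : Fin n) : psi γ g i 0 = 0 := by
  simp [psi, h.deriv_zero i]

theorem IsRegularizer.gamma_mul_lt_one {γ : Fin n → ℝ} {g : Fin n → ℝ → ℝ}
    (h : IsRegularizer γ g) (i : Fin n) (u : ℝ) : γ i * deriv (deriv (g i)) u < 1 := by
  have := h.deriv_deriv_lt i u
  rwa [lt_div_iff₀ (h.gamma_pos i), mul_comm] at this

theorem IsRegularizer.strictMono_psi {γ : Fin n → ℝ} {g : Fin n → ℝ → ℝ}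
    (h : IsRegularizer γ g) (i : Fin n) : StrictMono (psi γ g i) :=
  strictMono_of_deriv_pos fun u => by
    rw [(h.hasDerivAt_psi i u).deriv]
    linarith [h.gamma_mul_lt_one i u]

/-- The mean value theorem from 0, where `psi` vanishes. It turns curvature bounds into bounds on
`|psi| / |u|`. -/
theorem IsRegularizer.exists_psi_eq {γ : Fin n → ℝ} {g : Fin n → ℝ → ℝ}
    (h : IsRegularizer γ g) (i : Fin n) (u : ℝ) :
    ∃ ξ ∈ Set.uIcc 0 u, psi γ g i u = (1 - γ i * deriv (deriv (g i)) ξ) * u := by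
  have hd : Differentiable ℝ (psi γ g i) := fun v => (h.hasDerivAt_psi i v).differentiableAt
  rcases lt_trichotomy u 0 with hu | rfl | hu
  · obtain ⟨ξ, hξ, hs⟩ := exists_deriv_eq_slope (psi γ g i) hu hd.continuous.continuousOn
      hd.differentiableOn
    refine ⟨ξ, ?_, ?_⟩
    · rw [Set.uIcc_of_ge hu.le]; exact Set.Ioo_subset_Icc_self hξ
    · rw [(h.hasDerivAt_psi i ξ).deriv, h.psi_zero] at hs
      rw [hs]; field_simp; ring
  · exact ⟨0, by simp, by simp [h.psi_zero]⟩
  · obtain ⟨ξ, hξ, hs⟩ := exists_deriv_eq_slope (psi γ g i) hu hd.continuous.continuousOn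
      hd.differentiableOn
    refine ⟨ξ, ?_, ?_⟩
    · rw [Set.uIcc_of_le hu.le]; exact Set.Ioo_subset_Icc_self hξ
    · rw [(h.hasDerivAt_psi i ξ).deriv, h.psi_zero] at hs
      rw [hs]; field_simp; ring

theorem abs_le_abs_of_mem_uIcc {a b : ℝ} (h : a ∈ Set.uIcc 0 b) : |a| ≤ |b| := by
  simpa using Set.abs_sub_left_of_mem_uIcc h

section Curvature

variable {Φ : Matrix (Fin m) (Fin n) ℝ} {K : ℕ} {μ : ℝ} {γ : Fin n → ℝ} {g : Fin n → ℝ → ℝ}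
  {y : Vec m}

theorem boundE_nonneg (hμ : 0 < μ) (i : Fin n) : 0 ≤ boundE Φ K μ γ g y i :=
  le_max_of_le_right <| mul_nonneg
    (mul_nonneg hμ.le (Real.iSup_nonneg fun _ => norm_nonneg _)) (norm_nonneg _)

theorem IsRegularizer.upperL_mem_upperBounds (h : IsRegularizer γ g) {c : ℝ}
    (hc : c ∈ curvatures Φ K μ γ g y) : c ≤ upperL Φ K μ γ g y :=
  le_csSup ⟨1, by rintro _ ⟨i, u, _, rfl⟩; exact (h.gamma_mul_lt_one i u).le⟩ hc

theorem IsRegularizer.upperL_le_one (h : IsRegularizer γ g) : upperL Φ K μ γ g y ≤ 1 :=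
  -- This form also covers `n = 0`, where the supremum is 0 by default.
  Real.sSup_le (by rintro _ ⟨i, u, _, rfl⟩; exact (h.gamma_mul_lt_one i u).le) zero_le_one

theorem IsRegularizer.abs_psi_le_boundE (h : IsRegularizer γ g) (i : Fin n) {u : ℝ}
    (hu : |u| ≤ boundB Φ K y) : |psi γ g i u| ≤ boundE Φ K μ γ g y i := by
  refine le_max_of_le_left ?_
  obtain ⟨ξ, hξ, hs⟩ := h.exists_psi_eq i u
  have hpos : 0 < 1 - γ i * deriv (deriv (g i)) ξ := by linarith [h.gamma_mul_lt_one i ξ]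
  have hC : 1 - γ i * deriv (deriv (g i)) ξ ≤ boundC Φ K γ g y i := by
    refine le_csSup (isCompact_Icc.bddAbove_image ?_)
      ⟨ξ, abs_le.1 ((abs_le_abs_of_mem_uIcc hξ).trans hu), rfl⟩
    have := (h.differentiable_deriv i).2
    fun_prop
  rw [hs, abs_mul, abs_of_pos hpos, mul_comm]
  exact mul_le_mul hu hC hpos.le ((abs_nonneg u).trans hu)

/-- As `psi` is monotone and vanishes at 0, the mean value points between 0 and `u` satisfy the
constraint that `u` does. -/
theorem IsRegularizer.mem_curvatures (h : IsRegularizer γ g) (i : Fin n) {u ξ : ℝ}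
    (hu : |psi γ g i u| ≤ boundE Φ K μ γ g y i) (hξ : ξ ∈ Set.uIcc 0 u) :
    γ i * deriv (deriv (g i)) ξ ∈ curvatures Φ K μ γ g y := by
  refine ⟨i, ξ, abs_le.1 (le_trans (abs_le_abs_of_mem_uIcc ?_) hu), rfl⟩
  have := (h.strictMono_psi i).monotone.mapsTo_uIcc hξ
  rwa [h.psi_zero] at this

/-- When `L < 1`, the bound `(1 - L) * |u| ≤ |psi u|` confines the admissible `u` to a compact
interval, on which the continuous curvature is bounded below. -/
theorem IsRegularizer.bddBelow_curvatures (h : IsRegularizer γ g)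
    (hL : upperL Φ K μ γ g y < 1) : BddBelow (curvatures Φ K μ γ g y) := by
  set L := upperL Φ K μ γ g y with hLdef
  have hb : ∀ i, ∃ b, ∀ u, |u| ≤ boundE Φ K μ γ g y i / (1 - L) →
      b ≤ γ i * deriv (deriv (g i)) u := by
    intro i
    have hcont : Continuous fun u => γ i * deriv (deriv (g i)) u :=
      continuous_const.mul (h.differentiable_deriv i).2
    obtain ⟨b, hb⟩ := isCompact_Icc.bddBelow_image hcont.continuousOn
      (K := Set.Icc (-(boundE Φ K μ γ g y i / (1 - L))) (boundE Φ K μ γ g y i / (1 - L)))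
    exact ⟨b, fun u hu => hb ⟨u, abs_le.1 hu, rfl⟩⟩
  choose b hb using hb
  obtain ⟨β, hβ⟩ := Finite.bddBelow_range b
  refine ⟨β, ?_⟩
  rintro _ ⟨i, u, hu, rfl⟩
  have hu' := abs_le.2 hu
  refine (hβ ⟨i, rfl⟩).trans (hb i u ?_)
  obtain ⟨ξ, hξ, hs⟩ := h.exists_psi_eq i u
  have hc := h.upperL_mem_upperBounds (h.mem_curvatures i hu' hξ)
  rw [hs, abs_mul, abs_of_pos (by linarith [h.gamma_mul_lt_one i ξ])] at hu'
  rw [le_div_iff₀ (by linarith), mul_comm]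
  refine le_trans ?_ hu'
  gcongr

theorem IsRegularizer.lowerL_le_upperL (h : IsRegularizer γ g) (hμ : 0 < μ)
    (hL : upperL Φ K μ γ g y < 1) : lowerL Φ K μ γ g y ≤ upperL Φ K μ γ g y := by
  rcases isEmpty_or_nonempty (Fin n) with hn | ⟨⟨i⟩⟩
  · have : curvatures Φ K μ γ g y = ∅ :=
      Set.eq_empty_of_forall_notMem fun _ ⟨i, _⟩ => hn.elim i
    simp [lowerL, upperL, this]
  · have hmem := h.mem_curvatures (Φ := Φ) (K := K) (μ := μ) (y := y) i (u := 0) (ξ := 0)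
      (by simpa [h.psi_zero] using boundE_nonneg hμ i) (by simp)
    exact (csInf_le (h.bddBelow_curvatures hL) hmem).trans (h.upperL_mem_upperBounds hmem)

theorem IsRegularizer.abs_psi_bounds (h : IsRegularizer γ g) (hL : upperL Φ K μ γ g y < 1)
    (i : Fin n) {u : ℝ} (hu : |u| ≤ boundB Φ K y) :
    (1 - upperL Φ K μ γ g y) * |u| ≤ |psi γ g i u| ∧
      |psi γ g i u| ≤ (1 - lowerL Φ K μ γ g y) * |u| := by
  obtain ⟨ξ, hξ, hs⟩ := h.exists_psi_eq i u
  have hmem := h.mem_curvatures (μ := μ) i (h.abs_psi_le_boundE i hu) hξ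
  have h1 := h.upperL_mem_upperBounds hmem
  have h2 : lowerL Φ K μ γ g y ≤ _ := csInf_le (h.bddBelow_curvatures hL) hmem
  have hpos : 0 < 1 - γ i * deriv (deriv (g i)) ξ := by linarith [h.gamma_mul_lt_one i ξ]
  rw [hs, abs_mul, abs_of_pos hpos]
  constructor <;> gcongr

end Curvature

/-! ### Contraction of the missed energy -/

/-- On `Λ` the vector `Φᵗ Φ (x - xstar)` vanishes, so the error equals its residual there whatever
`τ` is. The freedom in `τ` is used in `IsLeastSquares.contraction`. -/
theorem IsLeastSquares.sum_sq_sub_le {Φ : Matrix (Fin m) (Fin n) ℝ} {K : ℕ} {xstar x : Vec n}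
    {Λ : Finset (Fin n)} (h : IsLeastSquares Φ (mulV Φ xstar) Λ x) (hΛ : Λ.card ≤ K)
    (hs : (supp xstar).card ≤ K) {τ : ℝ} (hτ0 : 0 ≤ τ) (hτ1 : τ ≤ 1)
    (hc : 0 < 1 - τ * (1 - ric Φ (2 * K))) :
    ∑ i ∈ Λ, (x - xstar) i ^ 2 ≤ (1 - τ * (1 - ric Φ (2 * K))) ^ 2 * ‖x - xstar‖ ^ 2 := by
  have hT : (Λ ∪ supp xstar).card ≤ 2 * K := (Finset.card_union_le _ _).trans (by omega)
  have he : supp (x - xstar) ⊆ Λ ∪ supp xstar := supp_subset_iff.2 fun i hi => by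
    simp only [Finset.mem_union, not_or, mem_supp, not_not] at hi
    simp [hi.2, supp_subset_iff.1 h.1 i hi.1]
  refine le_trans ?_ (sum_residualMap_sq_le Φ hT hτ0 hτ1 hc he)
  calc ∑ i ∈ Λ, (x - xstar) i ^ 2 = ∑ i ∈ Λ, residualMap Φ τ (x - xstar) i ^ 2 := by
        refine Finset.sum_congr rfl fun i hi => ?_
        have h0 := h.transpose_apply_eq_zero hi
        rw [← mulV_sub, ← neg_sub x xstar, ← neg_one_smul ℝ, mulV_smul, mulV_smul] at h0
        rw [residualMap_apply]
        have : mulV Φ.transpose (mulV Φ (x - xstar)) i = 0 := by simpa using h0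
        rw [this, mul_zero, sub_zero]
    _ ≤ _ := Finset.sum_le_sum_of_subset_of_nonneg Finset.subset_union_left
        fun _ _ _ => sq_nonneg _

theorem IsLeastSquares.norm_sub_sq_eq {Φ : Matrix (Fin m) (Fin n) ℝ} {y : Vec m}
    {xstar x : Vec n} {Λ : Finset (Fin n)} (h : IsLeastSquares Φ y Λ x) :
    ‖x - xstar‖ ^ 2 = ∑ i ∈ Λ, (x - xstar) i ^ 2 + ∑ i ∈ Λᶜ, xstar i ^ 2 := by
  rw [EuclideanSpace.real_norm_sq_eq, ← Finset.sum_add_sum_compl Λ]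
  congr 1
  refine Finset.sum_congr rfl fun i hi => ?_
  simp [supp_subset_iff.1 h.1 i (Finset.mem_compl.1 hi)]

/-- One step of hard thresholding, for abstract bounds on the curvature: the part of `xstar` missed
by the new support is controlled by the current error. -/
theorem IsHardThreshold.sum_compl_sq_le {Φ : Matrix (Fin m) (Fin n) ℝ} {K : ℕ}
    {xstar x xhat : Vec n} {Λ : Finset (Fin n)} (hLS : IsLeastSquares Φ (mulV Φ xstar) Λ x)
    (hΛ : Λ.card ≤ K) (hs : (supp xstar).card ≤ K)
    {μ : ℝ} (hμ : 0 < μ) {γ : Fin n → ℝ} {g : Fin n → ℝ → ℝ} (hreg : IsRegularizer γ g)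
    {l L : ℝ} (hlL : l ≤ L) (hL : L < 1)
    (hψ : ∀ i, (1 - L) * |x i| ≤ |psi γ g i (x i)| ∧ |psi γ g i (x i)| ≤ (1 - l) * |x i|)
    (hth : IsHardThreshold K (gradStep Φ (mulV Φ xstar) μ γ g x) xhat)
    (hτ1 : μ / (1 - L) ≤ 1) (hc : 0 < 1 - μ / (1 - L) * (1 - ric Φ (3 * K))) :
    ∑ i ∈ (supp xhat)ᶜ, xstar i ^ 2 ≤
      2 * ((1 - μ / (1 - L) * (1 - ric Φ (3 * K))) ^ 2 * ‖x - xstar‖ ^ 2 +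
        (((1 - l) / (1 - L)) ^ 2 - 1) * ∑ i ∈ Λ, (x - xstar) i ^ 2) := by
  obtain ⟨S, hScard, hSmax, hSv, hS0⟩ := hth
  set v := gradStep Φ (mulV Φ xstar) μ γ g x with hv
  have hL0 : 0 < 1 - L := by linarith
  set τ := μ / (1 - L) with hτ
  set t := (1 - l) / (1 - L) with ht
  have ht1 : 1 ≤ t := by rw [ht, le_div_iff₀ hL0]; linarith
  have ht2 : 0 ≤ t ^ 2 - 1 := by nlinarith
  set e := x - xstar with he
  have he_apply : ∀ i, e i = x i - xstar i := fun i => rfl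
  set A := residualMap Φ τ e with hA
  have hv_apply : ∀ i, v i = psi γ g i (x i) - μ * mulV Φ.transpose (mulV Φ e) i := by
    intro i
    have : mulV Φ xstar - mulV Φ x = (-1 : ℝ) • mulV Φ e := by
      rw [he, mulV_sub]; simp
    simp only [hv, gradStep, psi, this, mulV_smul]
    simp
    ring
  have hr : ∀ i ∈ Λ, mulV Φ.transpose (mulV Φ e) i = 0 := by
    intro i hi
    have h0 := hLS.transpose_apply_eq_zero hi
    rw [← mulV_sub, ← neg_sub x xstar, ← neg_one_smul ℝ, mulV_smul, mulV_smul] at h0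
    simpa using h0
  have hin : ∀ i ∈ Λ, A i = e i ∧ v i = psi γ g i (x i) := fun i hi => by
    rw [hA, residualMap_apply, hv_apply, hr i hi]; simp
  have hout : ∀ i ∉ Λ, x i = 0 ∧ A i = -xstar i + v i / (1 - L) := fun i hi => by
    have hx := supp_subset_iff.1 hLS.1 i hi
    refine ⟨hx, ?_⟩
    rw [hA, residualMap_apply, hv_apply, he_apply, hx, hreg.psi_zero, hτ]
    ring
  set P := supp xstar \ supp xhat with hP
  have hxhat : ∀ i, i ∈ supp xhat ↔ i ∈ S ∧ v i ≠ 0 := by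
    intro i
    rw [mem_supp]
    by_cases hi : i ∈ S
    · simp [hSv i hi, hi]
    · simp [hS0 i hi, hi]
  have hsumP : ∑ i ∈ (supp xhat)ᶜ, xstar i ^ 2 = ∑ i ∈ P, xstar i ^ 2 := by
    refine (Finset.sum_subset (fun i hi => ?_) fun i hi hi' => ?_).symm
    · exact Finset.mem_compl.2 (Finset.mem_sdiff.1 hi).2
    · by_contra h0
      exact hi' (Finset.mem_sdiff.2 ⟨mem_supp.2 fun h => h0 (by simp [h]), Finset.mem_compl.1 hi⟩)
  have hmissed : ∀ i, xstar i ^ 2 ≤ 2 * (A i ^ 2 + (v i / (1 - L)) ^ 2) := by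
    intro i
    have habs : |xstar i| ≤ |A i| + |v i / (1 - L)| := by
      by_cases hi : i ∈ Λ
      · have h1 : |x i| ≤ |v i / (1 - L)| := by
          rw [abs_div, abs_of_pos hL0, le_div_iff₀ hL0, (hin i hi).2, mul_comm]
          exact (hψ i).1
        have h2 : xstar i = x i - A i := by rw [(hin i hi).1, he_apply]; ring
        rw [h2]
        linarith [abs_sub (x i) (A i)]
      · have h2 : xstar i = v i / (1 - L) - A i := by rw [(hout i hi).2]; ring
        rw [h2]
        linarith [abs_sub (v i / (1 - L)) (A i)]
    calc xstar i ^ 2 = |xstar i| ^ 2 := (sq_abs _).symm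
      _ ≤ (|A i| + |v i / (1 - L)|) ^ 2 := by gcongr
      _ ≤ 2 * (|A i| ^ 2 + |v i / (1 - L)| ^ 2) := by
        nlinarith [sq_nonneg (|A i| - |v i / (1 - L)|)]
      _ = _ := by rw [sq_abs, sq_abs]
  set Q := S \ supp xstar with hQ
  have hchosen : ∀ j ∈ Q, (v j / (1 - L)) ^ 2 ≤
      A j ^ 2 + (t ^ 2 - 1) * (if j ∈ Λ then e j ^ 2 else 0) := by
    intro j hj
    have hxs : xstar j = 0 := by
      by_contra h0
      exact (Finset.mem_sdiff.1 hj).2 (mem_supp.2 h0)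
    by_cases hi : j ∈ Λ
    · rw [if_pos hi, (hin j hi).1, (hin j hi).2, he_apply, hxs, sub_zero]
      have h1 : |psi γ g j (x j) / (1 - L)| ≤ t * |x j| := by
        rw [abs_div, abs_of_pos hL0, ht, div_mul_eq_mul_div]
        gcongr
        exact (hψ j).2
      have h2 : |psi γ g j (x j) / (1 - L)| ^ 2 ≤ (t * |x j|) ^ 2 := by gcongr
      rw [sq_abs, mul_pow, sq_abs] at h2
      linarith
    · rw [if_neg hi, (hout j hi).2, hxs]
      simp
  -- A missed index inside `S` has `v i = 0`. The others are no more numerous than `Q`, and none has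
  -- a larger `|v i|` than an index of `Q`.
  have hPQ : ∑ i ∈ P, (v i / (1 - L)) ^ 2 ≤ ∑ j ∈ Q, (v j / (1 - L)) ^ 2 := by
    have h1 : ∑ i ∈ P, (v i / (1 - L)) ^ 2 = ∑ i ∈ supp xstar \ S, (v i / (1 - L)) ^ 2 := by
      refine (Finset.sum_subset (fun i hi => ?_) fun i hi hi' => ?_).symm
      · rw [Finset.mem_sdiff] at hi
        exact Finset.mem_sdiff.2 ⟨hi.1, fun h => hi.2 ((hxhat i).1 h).1⟩
      · rw [Finset.mem_sdiff] at hi hi'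
        have hiS : i ∈ S := by by_contra h; exact hi' ⟨hi.1, h⟩
        have : v i = 0 := by by_contra h; exact hi.2 ((hxhat i).2 ⟨hiS, h⟩)
        simp [this]
    have hcard : (supp xstar).card ≤ S.card := by
      rw [hScard]
      exact le_min hs ((Finset.card_le_univ _).trans_eq (Fintype.card_fin n))
    have hcard' : (supp xstar \ S).card ≤ Q.card := Finset.card_sdiff_le_card_sdiff_iff.2 hcard
    rw [h1]
    rcases (supp xstar \ S).eq_empty_or_nonempty with h0 | hne
    · rw [h0]; simp only [Finset.sum_empty]; positivity
    obtain ⟨i₀, hi₀, hmax⟩ := (supp xstar \ S).exists_max_image (fun i => (v i / (1 - L)) ^ 2) hne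
    calc _ ≤ (supp xstar \ S).card • (v i₀ / (1 - L)) ^ 2 := Finset.sum_le_card_nsmul _ _ _ hmax
      _ ≤ Q.card • (v i₀ / (1 - L)) ^ 2 := by gcongr
      _ ≤ _ := by
        refine Finset.card_nsmul_le_sum _ _ _ fun j hj => ?_
        rw [div_pow, div_pow, ← sq_abs (v i₀), ← sq_abs (v j)]
        have := hSmax j (Finset.mem_sdiff.1 hj).1 i₀ (Finset.mem_sdiff.1 hi₀).2
        gcongr
  have hdisj : Disjoint P Q := Finset.disjoint_left.2 fun i hi hj =>
    (Finset.mem_sdiff.1 hj).2 (Finset.mem_sdiff.1 hi).1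
  have hAT : ∑ i ∈ Λ ∪ supp xstar ∪ S, A i ^ 2 ≤ (1 - τ * (1 - ric Φ (3 * K))) ^ 2 * ‖e‖ ^ 2 := by
    have hSK : S.card ≤ K := hScard ▸ min_le_left _ _
    refine sum_residualMap_sq_le Φ ?_ (by positivity) hτ1 hc (supp_subset_iff.2 fun i hi => ?_)
    · have h1 := Finset.card_union_le (Λ ∪ supp xstar) S
      have h2 := Finset.card_union_le Λ (supp xstar)
      omega
    · simp only [Finset.mem_union, not_or, mem_supp, not_not] at hi
      simp [he_apply, hi.1.2, supp_subset_iff.1 hLS.1 i hi.1.1]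
  have hAPQ : ∑ i ∈ P, A i ^ 2 + ∑ i ∈ Q, A i ^ 2 ≤ ∑ i ∈ Λ ∪ supp xstar ∪ S, A i ^ 2 := by
    rw [← Finset.sum_union hdisj]
    refine Finset.sum_le_sum_of_subset_of_nonneg (fun i hi => ?_) fun _ _ _ => sq_nonneg _
    simp only [hP, hQ, Finset.mem_union, Finset.mem_sdiff] at hi ⊢
    tauto
  have heQ : ∑ j ∈ Q, (if j ∈ Λ then e j ^ 2 else 0) ≤ ∑ i ∈ Λ, e i ^ 2 := by
    rw [← Finset.sum_filter]
    exact Finset.sum_le_sum_of_subset_of_nonneg (fun i hi => (Finset.mem_filter.1 hi).2)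
      fun _ _ _ => sq_nonneg _
  rw [hsumP]
  calc ∑ i ∈ P, xstar i ^ 2 ≤ ∑ i ∈ P, 2 * (A i ^ 2 + (v i / (1 - L)) ^ 2) :=
        Finset.sum_le_sum fun i _ => hmissed i
    _ = 2 * (∑ i ∈ P, A i ^ 2 + ∑ i ∈ P, (v i / (1 - L)) ^ 2) := by
        rw [← Finset.mul_sum, Finset.sum_add_distrib]
    _ ≤ 2 * (∑ i ∈ P, A i ^ 2 + (∑ j ∈ Q, A j ^ 2 +
          (t ^ 2 - 1) * ∑ j ∈ Q, (if j ∈ Λ then e j ^ 2 else 0))) := by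
        have := hPQ.trans (Finset.sum_le_sum hchosen)
        rw [Finset.sum_add_distrib, ← Finset.mul_sum] at this
        gcongr
    _ ≤ _ := by
        have := mul_le_mul_of_nonneg_left heQ ht2
        linarith

theorem IsHardThreshold.card_supp_le {K : ℕ} {v w : Vec n} (h : IsHardThreshold K v w) :
    (supp w).card ≤ K := by
  obtain ⟨S, hS, -, -, h0⟩ := h
  exact (Finset.card_le_card (supp_subset_iff.2 h0)).trans (hS ▸ min_le_left _ _)

/-- The supports on which the iterates of a run are least squares estimates. -/
theorem IsRun.exists_supports {Φ : Matrix (Fin m) (Fin n) ℝ} {y : Vec m} {K : ℕ} {μ : ℝ}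
    {γ : Fin n → ℝ} {g : Fin n → ℝ → ℝ} {x : ℕ → Vec n} (hx : IsRun Φ y K μ γ g x) :
    ∃ Λ : ℕ → Finset (Fin n), (∀ k, (Λ k).card ≤ K ∧ IsLeastSquares Φ y (Λ k) (x k)) ∧
      ∀ k, ∃ xhat, IsHardThreshold K (gradStep Φ y μ γ g (x k)) xhat ∧ Λ (k + 1) = supp xhat := by
  obtain ⟨Λ₀, hΛ₀, hLS₀⟩ := hx.init
  choose xhat hth hLS using hx.step
  refine ⟨fun k => Nat.casesOn k Λ₀ fun k => supp (xhat k), fun k => ?_,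
    fun k => ⟨xhat k, hth k, rfl⟩⟩
  cases k with
  | zero => exact ⟨hΛ₀, hLS₀⟩
  | succ k => exact ⟨(hth k).card_supp_le, hLS k⟩

/-- The contraction estimate: with `a = μ (1 - δ_{3K}) / (1 - l)` and `p = μ (1 - δ_{2K}) / (1 - l)`,
the missed energy decays by the factor `2 (1 - a)² / (1 - (1 - p)²)`, and it controls the error. -/
theorem IsLeastSquares.contraction {Φ : Matrix (Fin m) (Fin n) ℝ} {K : ℕ}
    {xstar x xhat : Vec n} {Λ : Finset (Fin n)} (hLS : IsLeastSquares Φ (mulV Φ xstar) Λ x)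
    (hΛ : Λ.card ≤ K) (hs : (supp xstar).card ≤ K) (hδ : ric Φ (3 * K) < 1)
    {μ : ℝ} (hμ : 0 < μ) {γ : Fin n → ℝ} {g : Fin n → ℝ → ℝ} (hreg : IsRegularizer γ g)
    {l L : ℝ} (hlL : l ≤ L) (hL : L < 1)
    (hψ : ∀ i, (1 - L) * |x i| ≤ |psi γ g i (x i)| ∧ |psi γ g i (x i)| ≤ (1 - l) * |x i|)
    (hlow : 1 - 1 / √3 < μ * (1 - ric Φ (3 * K)) / (1 - l))
    (hup : μ * (1 - l) / (1 - L) ^ 2 * (1 + ric Φ (2 * K)) < 1)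
    (hth : IsHardThreshold K (gradStep Φ (mulV Φ xstar) μ γ g x) xhat) :
    (1 - muPrime Φ μ l (2 * K) ^ 2) * ∑ i ∈ (supp xhat)ᶜ, xstar i ^ 2 ≤
        2 * muPrime Φ μ l (3 * K) ^ 2 * ∑ i ∈ Λᶜ, xstar i ^ 2 ∧
      (∑ i ∈ Λᶜ, xstar i ^ 2 = 0 → x = xstar) := by
  have hL0 : 0 < 1 - L := by linarith
  have hl0 : 0 < 1 - l := by linarith
  have hδ2 : ric Φ (2 * K) ≤ ric Φ (3 * K) := ric_mono Φ (by omega)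
  have hδ0 : 0 ≤ ric Φ (2 * K) := ric_nonneg Φ _
  simp only [muPrime]
  set δ₂ := ric Φ (2 * K) with hδ₂
  set δ₃ := ric Φ (3 * K) with hδ₃
  set a := μ * (1 - δ₃) / (1 - l) with ha
  set p := μ * (1 - δ₂) / (1 - l) with hp
  set t := (1 - l) / (1 - L) with ht
  have ht1 : 1 ≤ t := by rw [ht, le_div_iff₀ hL0]; linarith
  have ht2 : 0 ≤ t ^ 2 - 1 := by nlinarith
  have hap : a ≤ p := by rw [ha, hp]; gcongr
  have ha0 : 0 < a := div_pos (mul_pos hμ (by linarith)) hl0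
  -- This step gives `τ₂ * (1 - δ₂) = t ^ 2 * p`, and the upper bound on `μ` says exactly `τ₂ * (1 +
  -- δ₂) < 1`.
  set τ₂ := μ * (1 - l) / (1 - L) ^ 2 with hτ₂
  have hτ₂0 : 0 < τ₂ := div_pos (mul_pos hμ hl0) (pow_pos hL0 2)
  have htp : t ^ 2 * p = τ₂ * (1 - δ₂) := by rw [ht, hp, hτ₂]; field_simp
  have hta : t * a = μ / (1 - L) * (1 - δ₃) := by rw [ht, ha]; field_simp
  have htτ : t * (μ / (1 - L)) = τ₂ := by rw [ht, hτ₂]; field_simp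
  have hτδ : 0 ≤ τ₂ * δ₂ := mul_nonneg hτ₂0.le hδ0
  have hτ₂1 : τ₂ < 1 := by linarith
  have hτ1 : μ / (1 - L) ≤ 1 :=
    (le_mul_of_one_le_left (div_pos hμ hL0).le ht1).trans (htτ ▸ hτ₂1.le)
  have htp1 : t ^ 2 * p < 1 := by rw [htp]; linarith
  have hta1 : t * a < 1 := by
    have h1 : a ≤ t * p := hap.trans (le_mul_of_one_le_left (ha0.le.trans hap) ht1)
    have h2 : t * a ≤ t * (t * p) := mul_le_mul_of_nonneg_left h1 (by linarith)
    linarith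
  have hb := hLS.sum_sq_sub_le hΛ hs hτ₂0.le hτ₂1.le (by rw [← hδ₂, ← htp]; linarith)
  have hstep := hth.sum_compl_sq_le hLS hΛ hs hμ hreg hlL hL hψ hτ1
    (by rw [← hδ₃, ← hta]; linarith)
  rw [← hδ₂, ← htp] at hb
  rw [← hδ₃, ← hta, ← ht] at hstep
  have hsplit := hLS.norm_sub_sq_eq (xstar := xstar)
  have hfac := contraction_factor_le hlow hap ht1 htp1
  have hp0 : 0 < p := by linarith
  have htp0 : 0 < t ^ 2 * p := by positivity
  have hp1 : p < 1 := (le_mul_of_one_le_left hp0.le (by linarith)).trans_lt htp1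
  constructor
  · set d := ∑ i ∈ Λᶜ, xstar i ^ 2
    set d' := ∑ i ∈ (supp xhat)ᶜ, xstar i ^ 2
    have hq0 : 0 ≤ 1 - (1 - p) ^ 2 :=
      sub_nonneg.2 (pow_le_one₀ (by linarith) (by linarith))
    have h1 : d' ≤ 2 * (((1 - t * a) ^ 2 + (t ^ 2 - 1) * (1 - t ^ 2 * p) ^ 2) *
        ‖x - xstar‖ ^ 2) := by
      have := mul_le_mul_of_nonneg_left hb ht2
      linarith
    calc (1 - (1 - p) ^ 2) * d' ≤ (1 - (1 - p) ^ 2) * (2 * (((1 - t * a) ^ 2 +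
          (t ^ 2 - 1) * (1 - t ^ 2 * p) ^ 2) * ‖x - xstar‖ ^ 2)) := by gcongr
      _ = 2 * (((1 - t * a) ^ 2 + (t ^ 2 - 1) * (1 - t ^ 2 * p) ^ 2) * (1 - (1 - p) ^ 2)) *
          ‖x - xstar‖ ^ 2 := by ring
      _ ≤ 2 * ((1 - a) ^ 2 * (1 - (1 - t ^ 2 * p) ^ 2)) * ‖x - xstar‖ ^ 2 := by gcongr
      _ = 2 * (1 - a) ^ 2 * (‖x - xstar‖ ^ 2 - (1 - t ^ 2 * p) ^ 2 * ‖x - xstar‖ ^ 2) := by ring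
      _ ≤ 2 * (1 - a) ^ 2 * d := by
        gcongr
        linarith
  · intro h0
    rw [h0, add_zero] at hsplit
    rw [← hsplit] at hb
    have h1 : 0 < 1 - (1 - t ^ 2 * p) ^ 2 :=
      sub_pos.2 (pow_lt_one₀ (by linarith) (by linarith) two_ne_zero)
    have h2 : ‖x - xstar‖ ^ 2 ≤ 0 := nonpos_of_mul_nonpos_right (by linarith) h1
    exact sub_eq_zero.1 (norm_eq_zero.1 (pow_eq_zero_iff two_ne_zero |>.1
      (le_antisymm h2 (sq_nonneg _))))

/-- Since `a ≤ p < 1`, `ρ ^ 2` is at most `2 (1 - a)² / (1 - (1 - a)²)`, which is below 1 exactly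
when `3 (1 - a)² < 1`: the origin of `1 / √3`. -/
theorem rho_pos_and_lt_one {Φ : Matrix (Fin m) (Fin n) ℝ} {K : ℕ} {μ l : ℝ} (hμ : 0 < μ)
    (hl : 0 < 1 - l) (hδ : ric Φ (3 * K) < 1)
    (hlow : 1 - 1 / √3 < μ * (1 - ric Φ (3 * K)) / (1 - l))
    (hp : μ * (1 - ric Φ (2 * K)) / (1 - l) < 1) :
    0 < rho Φ μ l K ∧ rho Φ μ l K < 1 ∧ 0 < 1 - muPrime Φ μ l (2 * K) ^ 2 ∧
      rho Φ μ l K ^ 2 = 2 * muPrime Φ μ l (3 * K) ^ 2 / (1 - muPrime Φ μ l (2 * K) ^ 2) := by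
  have hδ2 : ric Φ (2 * K) ≤ ric Φ (3 * K) := ric_mono Φ (by omega)
  have hap : μ * (1 - ric Φ (3 * K)) / (1 - l) ≤ μ * (1 - ric Φ (2 * K)) / (1 - l) := by gcongr
  simp only [rho, muPrime]
  set a := μ * (1 - ric Φ (3 * K)) / (1 - l) with ha
  set p := μ * (1 - ric Φ (2 * K)) / (1 - l)
  have ha0 : 0 < a := div_pos (mul_pos hμ (by linarith)) hl
  have hq0 : 0 < 1 - (1 - p) ^ 2 := by nlinarith
  have hsq : (√2 * (1 - a) / √(1 - (1 - p) ^ 2)) ^ 2 =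
      2 * (1 - a) ^ 2 / (1 - (1 - p) ^ 2) := by
    rw [div_pow, mul_pow, Real.sq_sqrt zero_le_two, Real.sq_sqrt hq0.le]
  have ha1 : 0 < 1 - a := by linarith
  have hpos : 0 < √2 * (1 - a) / √(1 - (1 - p) ^ 2) := by positivity
  refine ⟨hpos, ?_, hq0, hsq⟩
  have h3 : (1 - a) ^ 2 < 1 / 3 := by
    have h : (1 - a) ^ 2 < (1 / √3) ^ 2 := by
      have : 1 - a < 1 / √3 := by linarith
      gcongr
    rwa [div_pow, one_pow, Real.sq_sqrt (by norm_num)] at h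
  have h4 : (1 - p) ^ 2 ≤ (1 - a) ^ 2 := by
    have : 0 ≤ 1 - p := by linarith
    gcongr
  have h5 : (√2 * (1 - a) / √(1 - (1 - p) ^ 2)) ^ 2 < 1 ^ 2 := by
    rw [hsq, div_lt_iff₀ hq0]; linarith
  exact (sq_lt_sq₀ hpos.le zero_le_one).1 h5

end RHTP

/-! ### Exact recovery -/

theorem mainTheorem5 {m n : ℕ} (Φ : Matrix (Fin m) (Fin n) ℝ) (K : ℕ) (hK : 1 ≤ K)
    (hRIP : RHTP.ric Φ (3 * K) < 1)
    (γ : Fin n → ℝ) (g : Fin n → ℝ → ℝ) (hreg : RHTP.IsRegularizer γ g)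
    (μ : ℝ) (hμ : 0 < μ)
    (xstar : RHTP.Vec n) (hsparse : (RHTP.supp xstar).card ≤ K)
    (y : RHTP.Vec m) (hy : y = RHTP.mulV Φ xstar)
    (l L ρ : ℝ) (hl : l = RHTP.lowerL Φ K μ γ g y) (hL : L = RHTP.upperL Φ K μ γ g y)
    (hρ : ρ = RHTP.rho Φ μ l K)
    (hlow : (1 - 1 / √3) * (1 - l) / (1 - RHTP.ric Φ (3 * K)) < μ)
    (hup : μ < (1 - L) ^ 2 / ((1 - l) * (1 + RHTP.ric Φ (2 * K))))
    (x : ℕ → RHTP.Vec n) (hx : RHTP.IsRun Φ y K μ γ g x) :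
    0 < ρ ∧ ρ < 1 ∧
      ∃ N : ℕ, (N : ℝ) ≤ Real.log (4 / ρ ^ 2) / Real.log (1 / ρ ^ 2) * K ∧
        ∀ k, N ≤ k → x k = xstar := by
  -- For `L = 1` the upper bound on the step size would read `μ < 0`.
  have hL1 : L < 1 := by
    refine lt_of_le_of_ne (hL ▸ hreg.upperL_le_one) fun h => ?_
    rw [h, sub_self, zero_pow two_ne_zero, zero_div] at hup
    linarith
  have hlL : l ≤ L := by
    rw [hl, hL]
    exact hreg.lowerL_le_upperL hμ (hL ▸ hL1)
  have hL0 : 0 < 1 - L := by linarith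
  have hl0 : 0 < 1 - l := by linarith
  have hδ2 : RHTP.ric Φ (2 * K) ≤ RHTP.ric Φ (3 * K) := RHTP.ric_mono Φ (by omega)
  have hδ20 : 0 ≤ RHTP.ric Φ (2 * K) := RHTP.ric_nonneg Φ _
  have hδ1 : RHTP.ric Φ K < 1 := (RHTP.ric_mono Φ (by omega)).trans_lt hRIP
  have hlow' : 1 - 1 / √3 < μ * (1 - RHTP.ric Φ (3 * K)) / (1 - l) := by
    rw [div_lt_iff₀ (by linarith)] at hlow
    rwa [lt_div_iff₀ hl0]
  have hup' : μ * (1 - l) / (1 - L) ^ 2 * (1 + RHTP.ric Φ (2 * K)) < 1 := by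
    rw [lt_div_iff₀ (by positivity)] at hup
    rw [div_mul_eq_mul_div, div_lt_one (by positivity)]
    linarith
  have hp1 : μ * (1 - RHTP.ric Φ (2 * K)) / (1 - l) < 1 := by
    rw [lt_div_iff₀ (by positivity)] at hup
    rw [div_lt_one hl0]
    have h1 : (1 - L) ^ 2 ≤ (1 - l) ^ 2 := by gcongr
    have h2 : μ * (1 + RHTP.ric Φ (2 * K)) < 1 - l := by
      refine lt_of_mul_lt_mul_left ?_ hl0.le
      linarith
    have h3 := mul_nonneg hμ.le hδ20
    linarith
  obtain ⟨hρ0, hρ1, hq0, hρsq⟩ := RHTP.rho_pos_and_lt_one hμ hl0 hRIP hlow' hp1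
  rw [← hρ] at hρ0 hρ1 hρsq
  obtain ⟨Λ, hΛ, hth⟩ := hx.exists_supports
  have hψ : ∀ k i, (1 - L) * |x k i| ≤ |RHTP.psi γ g i (x k i)| ∧
      |RHTP.psi γ g i (x k i)| ≤ (1 - l) * |x k i| := by
    intro k i
    rw [hl, hL]
    refine hreg.abs_psi_bounds (hL ▸ hL1) i (le_trans ?_ ((hΛ k).2.norm_le_boundB (hΛ k).1 hδ1))
    exact PiLp.norm_apply_le (x k) i
  have hcon : ∀ k, ∑ i ∈ (Λ (k + 1))ᶜ, xstar i ^ 2 ≤ ρ ^ 2 * ∑ i ∈ (Λ k)ᶜ, xstar i ^ 2 ∧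
      (∑ i ∈ (Λ k)ᶜ, xstar i ^ 2 = 0 → x k = xstar) := by
    intro k
    obtain ⟨xhat, hxhat, hsucc⟩ := hth k
    have h := (hy ▸ (hΛ k).2).contraction (hΛ k).1 hsparse hRIP hμ hreg hlL hL1 (hψ k)
      hlow' hup' (hy ▸ hxhat)
    refine ⟨?_, h.2⟩
    rw [hsucc, hρsq, div_mul_eq_mul_div, le_div_iff₀ hq0, mul_comm]
    exact h.1
  refine ⟨hρ0, hρ1, ?_⟩
  have hr0 : 0 < ρ ^ 2 := by positivity
  have hr1 : ρ ^ 2 < 1 := pow_lt_one₀ hρ0.le hρ1 two_ne_zero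
  have hzero : ∀ i ∉ RHTP.supp xstar, xstar i ^ 2 = 0 := fun i hi => by
    simpa using hi
  obtain ⟨N, hN0, hN⟩ := RHTP.exists_sum_compl_eq_zero_of_sum_le
    (fun i => sq_nonneg (xstar i)) hr0 hr1 (fun k => (hcon k).1) (RHTP.supp xstar)
    (fun i hi => by have := RHTP.mem_supp.1 hi; positivity)
    (fun i _ j hj h => absurd (hzero j hj) h.ne')
    -- Any positive bound on the squared entries serves; the added 1 covers `xstar = 0`.
    (‖xstar‖ ^ 2 + 1) (by positivity)
    (fun i _ => by
      have : ‖xstar i‖ ^ 2 ≤ ‖xstar‖ ^ 2 := by gcongr; exact PiLp.norm_apply_le xstar i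
      rw [Real.norm_eq_abs, sq_abs] at this
      linarith)
    0 ((Finset.sum_le_sum_of_subset_of_nonneg (Finset.subset_univ _)
      fun _ _ _ => sq_nonneg _).trans_eq
        (Finset.sum_subset (Finset.subset_univ _) fun i _ hi => hzero i hi).symm)
  rw [zero_add] at hN0
  refine ⟨N, ?_, fun k hk => ?_⟩
  · have hlam : 0 < Real.log (1 / ρ ^ 2) := Real.log_pos (by rw [lt_div_iff₀ hr0]; linarith)
    have hlog : Real.log (4 / ρ ^ 2) = Real.log (1 / ρ ^ 2) + Real.log 4 := by
      rw [← Real.log_mul (by positivity) (by norm_num)]; congr 1; ring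
    rw [div_mul_eq_mul_div, le_div_iff₀ hlam, hlog]
    have h1 : 0 ≤ (∑ i ∈ RHTP.supp xstar, xstar i ^ 2) / (‖xstar‖ ^ 2 + 1) / 2 := by positivity
    have h2 : (0 : ℝ) ≤ Real.log 4 := Real.log_nonneg (by norm_num)
    have h3 : ((RHTP.supp xstar).card : ℝ) * (Real.log (1 / ρ ^ 2) + Real.log 4) ≤
        K * (Real.log (1 / ρ ^ 2) + Real.log 4) := by gcongr
    linarith
  -- Once zero, the missed energy stays zero by the contraction.
  · refine (hcon k).2 ?_
    induction k, hk using Nat.le_induction with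
    | base => exact hN0
    | succ k _ ih =>
      refine le_antisymm ?_ (Finset.sum_nonneg fun _ _ => sq_nonneg _)
      have := (hcon k).1
      rwa [ih, mul_zero] at this
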